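/- For a rational number $a$ and an integer $n\ge 0$ let $(a)_n=a(a+1)\cdots(a+n-1)$ denote the rising factorial, with $(a)_0=1$. For rational numbers $x,y$ and a positive integer $m$, write $x\equiv y\pmod m$ if $m$ divides the numerator of $x-y$ written in lowest terms. Let $p$ be a prime with $p\equiv 3\pmod 4$ and let $r\ge 1$ be an integer. Then $$\sum_{k=0}^{(p^{2r}-1)/2}\frac{(\frac12)_k^3}{k!^3}\equiv p^{2r}\,\frac{(\frac34)_{(p^{2r}-1)/2}}{(\frac54)_{(p^{2r}-1)/2}}\pmod{p^{2r+2}}$$ and $$\sum_{k=0}^{p^{2r}-1}\frac{(\frac12)_k^3}{k!^3}\equiv p^{2r}\,\frac{(\frac34)_{(p^{2r}-1)/2}}{(\frac54)_{(p^{2r}-1)/2}}\pmod{p^{2r+2}}.$$ -/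

import Mathlib

/-- Congruence of rational numbers modulo `m`: the integer `m` divides the numerator of `x - y` in
lowest terms. (The denominator of `x - y` is then coprime to `m`. For a prime power `m = p ^ e`
with `e ≥ 1` this says that `x - y` lies in `p ^ e ℤ_(p)`.) -/
def RatModEq (m : ℕ) (x y : ℚ) : Prop :=
  (m : ℤ) ∣ (x - y).num

/-- The rising factorial `(a)_n = a (a + 1) ⋯ (a + n - 1)` of a rational number. -/
def risingFactorial (a : ℚ) (n : ℕ) : ℚ :=
  ∏ i ∈ Finset.range n, (a + (i : ℚ))

/-!
Write `h k = (1/2)_k / k!`. As a function of `y`, the `k`-th summand of the `₃F₂` series with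
parameters `1/2`, `1/2 + √y`, `1/2 - √y` vanishes at `y = (j + 1/2)²` for `j < k`, and at `y = 0`
it equals `h k ^ 3`. Lagrange interpolation from these nodes to `0` therefore expands `∑ h k ^ 3`
into terminating series, and Watson's theorem evaluates each of them: it is `0` for odd `j` and an
explicit square for even `j`. The `j`-th term of the expansion is a product of binomial
coefficients divided by `2 j + 1`. Because `p ≡ 3 (mod 4)`, a divisibility `p ^ g ∣ 4 M + 1` forces
a carry at every odd position up to `g` when `M` is added to itself in base `p`, so the central
binomial coefficient of `M` absorbs enough of the denominator `4 M + 1`. Modulo `p ^ (2 r + 2)`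
only the top node `j = (p ^ (2 r) - 1) / 2` survives, and its term is the right-hand side.

The terms with `k > (p ^ (2 r) - 1) / 2` are first interpolated at the nodes `l²`, which turns their
sum into shifted series of the same kind; now every term vanishes modulo `p ^ (2 r + 2)`.
-/

section Lagrange

variable {F ι τ : Type*} [Field F]

open Polynomial in
lemma degree_prod_one_sub_C_mul_X_le (S : Finset ι) (w : ι → F) :
    (∏ j ∈ S, (1 - C (w j) * X)).degree ≤ (S.card : WithBot ℕ) := by
  have hlinear (j : ι) : (1 - C (w j) * X).degree ≤ (1 : WithBot ℕ) :=
    (degree_sub_le _ _).trans (max_le (degree_one_le.trans zero_le_one) (degree_C_mul_X_le _))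
  refine (degree_prod_le _ _).trans ?_
  simpa using Finset.sum_le_card_nsmul S _ 1 fun j _ => hlinear j

variable [DecidableEq ι]

/-- The value at `0` of the Lagrange basis polynomial attached to the node `v i`, among the nodes
`v j` with `j ∈ s`. All nodes are meant to be nonzero. -/
def lagrangeWeight (s : Finset ι) (v : ι → F) (i : ι) : F :=
  ∏ j ∈ s.erase i, (1 - v i / v j)⁻¹

lemma eval_zero_lagrangeBasis {s : Finset ι} {v : ι → F} (hv : ∀ j ∈ s, v j ≠ 0) (i : ι) :
    (Lagrange.basis s v i).eval 0 = lagrangeWeight s v i := by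
  rw [Lagrange.basis, Polynomial.eval_prod, lagrangeWeight]
  refine Finset.prod_congr rfl fun j hj => ?_
  have hj0 := hv j (Finset.mem_of_mem_erase hj)
  rw [one_sub_div hj0, inv_div, ← neg_div_neg_eq, neg_sub]
  simp [Lagrange.basisDivisor, div_eq_inv_mul]

open Polynomial in
lemma sum_eq_sum_mul_lagrangeWeight {s : Finset ι} {v : ι → F} (hinj : Set.InjOn v s)
    (hv : ∀ j ∈ s, v j ≠ 0) (T : Finset τ) (c : τ → F) {S : τ → Finset ι}
    (hS : ∀ t ∈ T, (S t).card < s.card) :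
    ∑ t ∈ T, c t =
      ∑ i ∈ s, (∑ t ∈ T, c t * ∏ j ∈ S t, (1 - v i / v j)) * lagrangeWeight s v i := by
  set P : F[X] := ∑ t ∈ T, C (c t) * ∏ j ∈ S t, (1 - C (v j)⁻¹ * X) with hP
  have heval (y : F) : P.eval y = ∑ t ∈ T, c t * ∏ j ∈ S t, (1 - y / v j) := by
    simp [hP, eval_finsetSum, eval_prod, div_eq_inv_mul]
  have hdeg : P.degree < s.card := by
    rw [← mem_degreeLT]
    refine Submodule.sum_mem _ fun t ht => ?_
    rw [← smul_eq_C_mul]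
    refine Submodule.smul_mem _ _ (mem_degreeLT.2 ?_)
    exact (degree_prod_one_sub_C_mul_X_le _ _).trans_lt (mod_cast hS t ht)
  calc ∑ t ∈ T, c t = P.eval 0 := by simp [heval]
    _ = ∑ i ∈ s, P.eval (v i) * (Lagrange.basis s v i).eval 0 := by
        conv_lhs => rw [Lagrange.eq_interpolate hinj hdeg]
        simp [Lagrange.interpolate_apply, eval_finsetSum]
    _ = _ := by simp only [heval, eval_zero_lagrangeBasis hv]

end Lagrange

section Watson

variable {K : Type*} [Field K]

/-- The term of index `t` of the series
`₃F₂(a + 1/2, a + 1/2 + √y, a + 1/2 - √y; a + 1, 2a + 1; 1)`, a polynomial in the parameter `y`. -/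
def watsonTerm (a y : K) (t : ℕ) : K :=
  ∏ i ∈ Finset.range t,
    ((a + 1 / 2 + i) * ((a + 1 / 2 + i) ^ 2 - y) / ((a + 1 + i) * (i + 1) * (2 * a + 1 + i)))

/-- The value of the parameter for which the `₃F₂` series of `watsonTerm` terminates after the
term of index `j`. -/
def watsonNode (a : K) (j : ℕ) : K :=
  (a + 1 / 2 + j) ^ 2

/-- The terminating series `₃F₂(a + 1/2, -j, 2a + 1 + j; a + 1, 2a + 1; 1)` of Watson's summation
theorem. -/
def watsonSum (a : K) (j : ℕ) : K :=
  ∑ t ∈ Finset.range (j + 1), watsonTerm a (watsonNode a j) t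

lemma watsonTerm_succ (a y : K) (t : ℕ) :
    watsonTerm a y (t + 1) = watsonTerm a y t *
      ((a + 1 / 2 + t) * ((a + 1 / 2 + t) ^ 2 - y) /
        ((a + 1 + t) * (t + 1) * (2 * a + 1 + t))) :=
  Finset.prod_range_succ _ _

lemma watsonTerm_watsonNode_of_lt (a : K) {j t : ℕ} (h : j < t) :
    watsonTerm a (watsonNode a j) t = 0 :=
  Finset.prod_eq_zero (Finset.mem_range.2 h) (by simp [watsonNode])

lemma sum_watsonTerm_watsonNode (a : K) {j D : ℕ} (h : j < D) :
    ∑ t ∈ Finset.range D, watsonTerm a (watsonNode a j) t = watsonSum a j := by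
  refine (Finset.sum_subset (Finset.range_subset_range.2 h) fun t _ ht => ?_).symm
  exact watsonTerm_watsonNode_of_lt a (by simpa using ht)

variable [LinearOrder K] [IsStrictOrderedRing K] {a : K}

lemma watsonTerm_watsonNode_eq_add_two (ha : 0 ≤ a) (j t : ℕ) :
    watsonTerm a (watsonNode a j) t = watsonTerm a (watsonNode a (j + 2)) t *
      ((t - j - 2) * (t - j - 1) * (2 * a + j + 1) * (2 * a + j + 2) /
        ((j + 1) * (j + 2) * (2 * a + j + t + 1) * (2 * a + j + t + 2))) := by
  induction t with
  | zero =>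
    simp only [watsonTerm, Finset.range_zero, Finset.prod_empty, Nat.cast_zero]
    field_simp
    ring
  | succ t ih =>
    rw [watsonTerm_succ, watsonTerm_succ, ih, watsonNode, watsonNode]
    push_cast
    field_simp
    ring

-- The right-hand side is the certificate produced by Zeilberger's algorithm.
lemma sum_watsonTerm_telescope (ha : 0 ≤ a) (j T : ℕ) :
    ∑ t ∈ Finset.range T, ((2 * a + 2 + j) ^ 2 * watsonTerm a (watsonNode a (j + 2)) t -
      (j + 1) ^ 2 * watsonTerm a (watsonNode a j) t) =
    -(2 * (2 * j + 2 * a + 3) * (j + 2 * a + 2) * T * (T + a) * (T + 2 * a) /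
      ((j + 2) * (2 * a + j + T + 1) * (2 * a + j + T + 2))) *
      watsonTerm a (watsonNode a (j + 2)) T := by
  induction T with
  | zero => simp
  | succ T ih =>
    rw [Finset.sum_range_succ, ih, watsonTerm_succ, watsonTerm_watsonNode_eq_add_two ha j T,
      watsonNode]
    push_cast
    field_simp
    ring

lemma watsonSum_add_two (ha : 0 ≤ a) (j : ℕ) :
    (2 * a + 2 + j) ^ 2 * watsonSum a (j + 2) = (j + 1) ^ 2 * watsonSum a j := by
  have h := sum_watsonTerm_telescope ha j (j + 3)
  rw [watsonTerm_watsonNode_of_lt a (show j + 2 < j + 3 by omega), mul_zero,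
    Finset.sum_sub_distrib, ← Finset.mul_sum, ← Finset.mul_sum,
    sum_watsonTerm_watsonNode a (show j + 2 < j + 3 by omega),
    sum_watsonTerm_watsonNode a (show j < j + 3 by omega)] at h
  exact sub_eq_zero.1 h

lemma watsonSum_odd (ha : 0 ≤ a) (M : ℕ) : watsonSum a (2 * M + 1) = 0 := by
  induction M with
  | zero =>
    simp only [watsonSum, watsonNode, watsonTerm, Finset.sum_range_succ, Finset.prod_range_succ,
      Finset.range_zero]
    norm_num
    field_simp
    ring
  | succ M ih =>
    have h := watsonSum_add_two ha (2 * M + 1)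
    rw [ih, mul_zero] at h
    exact (mul_eq_zero.1 h).resolve_left (by positivity)

lemma watsonSum_even (ha : 0 ≤ a) (M : ℕ) :
    watsonSum a (2 * M) = (∏ i ∈ Finset.range M, ((2 * i + 1) / (2 * a + 2 + 2 * i))) ^ 2 := by
  induction M with
  | zero => simp [watsonSum, watsonTerm]
  | succ M ih =>
    have h := watsonSum_add_two ha (2 * M)
    have hpos : (2 * a + 2 + (2 * M : ℕ)) ^ 2 ≠ 0 := by positivity
    refine mul_left_cancel₀ hpos (h.trans ?_)
    rw [ih, Finset.prod_range_succ]
    push_cast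
    field_simp

lemma watsonNode_pos (ha : 0 ≤ a) (j : ℕ) : 0 < watsonNode a j := by
  rw [watsonNode]
  positivity

lemma watsonNode_injective (ha : 0 ≤ a) : Function.Injective (watsonNode a) := by
  intro i j hij
  have h := (pow_left_inj₀ (by positivity) (by positivity) two_ne_zero).1 hij
  exact_mod_cast add_left_cancel h

lemma watsonTerm_eq_mul_prod (ha : 0 ≤ a) (y : K) (t : ℕ) :
    watsonTerm a y t = watsonTerm a 0 t * ∏ i ∈ Finset.range t, (1 - y / watsonNode a i) := by
  rw [watsonTerm, watsonTerm, ← Finset.prod_mul_distrib]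
  refine Finset.prod_congr rfl fun i _ => ?_
  rw [watsonNode]
  field_simp
  ring

lemma sum_watsonTerm_zero (ha : 0 ≤ a) (D : ℕ) :
    ∑ t ∈ Finset.range D, watsonTerm a 0 t =
      ∑ j ∈ Finset.range D,
        watsonSum a j * lagrangeWeight (Finset.range D) (watsonNode a) j := by
  rw [sum_eq_sum_mul_lagrangeWeight (s := Finset.range D) (S := Finset.range)
    (watsonNode_injective ha).injOn (fun j _ => (watsonNode_pos ha j).ne') _ _ (by simp)]
  refine Finset.sum_congr rfl fun j hj => ?_
  simp_rw [← sum_watsonTerm_watsonNode a (Finset.mem_range.1 hj), ← watsonTerm_eq_mul_prod ha]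

end Watson

section CentralRatio

/-- The rational number `(1/2)_k / k!`, written with the central binomial coefficient. -/
def centralRatio (k : ℕ) : ℚ :=
  k.centralBinom / 4 ^ k

lemma centralRatio_zero : centralRatio 0 = 1 := by
  simp [centralRatio]

lemma centralRatio_pos (k : ℕ) : 0 < centralRatio k :=
  div_pos (mod_cast k.centralBinom_pos) (by positivity)

lemma centralRatio_ne_zero (k : ℕ) : centralRatio k ≠ 0 :=
  (centralRatio_pos k).ne'

lemma centralRatio_succ (k : ℕ) :
    centralRatio (k + 1) = centralRatio k * ((k + 1 / 2) / (k + 1)) := by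
  have h : ((k : ℚ) + 1) * (k + 1).centralBinom = 2 * (2 * k + 1) * k.centralBinom := by
    exact_mod_cast Nat.succ_mul_centralBinom_succ k
  rw [centralRatio, centralRatio, pow_succ]
  field_simp
  linarith

lemma factorial_two_mul_eq_centralRatio (k : ℕ) :
    ((2 * k).factorial : ℚ) = centralRatio k * 4 ^ k * k.factorial ^ 2 := by
  rw [centralRatio, Nat.centralBinom, Nat.cast_choose ℚ (by omega : k ≤ 2 * k),
    show 2 * k - k = k by omega]
  field_simp

lemma risingFactorial_natCast_add_one (m k : ℕ) :
    risingFactorial (m + 1) k = (m + k).factorial / m.factorial := by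
  rw [eq_div_iff (by positivity), mul_comm, ← Nat.factorial_mul_ascFactorial,
    Nat.ascFactorial_eq_prod_range, risingFactorial]
  push_cast
  rfl

lemma risingFactorial_natCast_add_half (l k : ℕ) :
    risingFactorial (l + 1 / 2) k =
      centralRatio (l + k) * (l + k).factorial / (centralRatio l * l.factorial) := by
  have := centralRatio_ne_zero l
  induction k with
  | zero => simp [risingFactorial, Nat.factorial_ne_zero, this]
  | succ k ih =>
    rw [risingFactorial, Finset.prod_range_succ, ← risingFactorial, ih, ← add_assoc,
      centralRatio_succ, Nat.factorial_succ]
    push_cast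
    field_simp
    ring

lemma risingFactorial_half_div_factorial (k : ℕ) :
    risingFactorial (1 / 2) k / k.factorial = centralRatio k := by
  have h := risingFactorial_natCast_add_half 0 k
  simp only [Nat.cast_zero, zero_add, centralRatio_zero, Nat.factorial_zero, Nat.cast_one,
    mul_one, div_one] at h
  rw [h]
  field_simp

lemma prod_range_odd_div_even (l M : ℕ) :
    ∏ i ∈ Finset.range M, ((2 * i + 1 : ℚ) / (2 * l + 2 + 2 * i)) =
      centralRatio M / (l + M).choose M := by
  have hodd := risingFactorial_natCast_add_half 0 M
  have heven := risingFactorial_natCast_add_one l M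
  simp only [Nat.cast_zero, zero_add, centralRatio_zero, Nat.factorial_zero, Nat.cast_one,
    mul_one, div_one] at hodd
  calc ∏ i ∈ Finset.range M, ((2 * i + 1 : ℚ) / (2 * l + 2 + 2 * i))
      = risingFactorial (1 / 2) M / risingFactorial (l + 1) M := by
        rw [risingFactorial, risingFactorial, ← Finset.prod_div_distrib]
        refine Finset.prod_congr rfl fun i _ => ?_
        field_simp
        ring
    _ = centralRatio M / (l + M).choose M := by
        rw [hodd, heven, Nat.cast_choose ℚ (Nat.le_add_left M l), Nat.add_sub_cancel]
        field_simp

lemma watsonSum_natCast_even (l M : ℕ) :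
    watsonSum (l : ℚ) (2 * M) = (centralRatio M / (l + M).choose M) ^ 2 := by
  rw [watsonSum_even (Nat.cast_nonneg l), prod_range_odd_div_even]

lemma prod_range_sub_self (x : ℕ) :
    ∏ i ∈ Finset.range x, ((i : ℚ) - x) = (-1) ^ x * x.factorial := by
  induction x with
  | zero => simp
  | succ x ih =>
    rw [Finset.prod_range_succ', Nat.factorial_succ, pow_succ]
    push_cast
    simp only [add_sub_add_right_eq_sub, ih]
    ring

lemma prod_range_sub_mul_add (m x : ℕ) :
    ∏ i ∈ Finset.range x, (((i : ℚ) - x) * (m + x + 1 + i)) =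
      (-1) ^ x * x.factorial * ((m + 2 * x).factorial / (m + x).factorial) := by
  have h := risingFactorial_natCast_add_one (m + x) x
  rw [risingFactorial] at h
  push_cast at h
  rw [Finset.prod_mul_distrib, prod_range_sub_self, h, two_mul, add_assoc]

lemma prod_range_erase {β : Type*} [CommMonoid β] (f : ℕ → β) (x d : ℕ) :
    ∏ b ∈ (Finset.range (x + 1 + d)).erase x, f b =
      (∏ b ∈ Finset.range x, f b) * ∏ i ∈ Finset.range d, f (x + 1 + i) := by
  have herase : (Finset.range (x + 1 + d)).erase x =
      (Finset.range x).disjUnion (Finset.Ico (x + 1) (x + 1 + d))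
        (Finset.disjoint_left.2 fun i => by simp; omega) := by
    ext i
    simp only [Finset.mem_erase, Finset.mem_range, Finset.mem_Ico, Finset.mem_disjUnion]
    omega
  rw [herase, Finset.prod_disjUnion, Finset.prod_Ico_eq_prod_range, Nat.add_sub_cancel_left]

lemma watsonNode_sub (a : ℚ) (b x : ℕ) :
    watsonNode a b - watsonNode a x = (b - x) * (2 * a + x + 1 + b) := by
  rw [watsonNode, watsonNode]
  ring

lemma prod_erase_watsonNode (l x d : ℕ) :
    ∏ b ∈ (Finset.range (x + 1 + d)).erase x, watsonNode (l : ℚ) b =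
      (centralRatio (l + (x + 1 + d)) * (l + (x + 1 + d)).factorial /
        (centralRatio l * l.factorial)) ^ 2 / watsonNode (l : ℚ) x := by
  rw [eq_div_iff (watsonNode_pos (Nat.cast_nonneg l) x).ne',
    Finset.prod_erase_mul _ _ (Finset.mem_range.2 (by omega)),
    ← risingFactorial_natCast_add_half, risingFactorial, ← Finset.prod_pow]
  rfl

lemma prod_erase_watsonNode_sub (l x d : ℕ) :
    ∏ b ∈ (Finset.range (x + 1 + d)).erase x, (watsonNode (l : ℚ) b - watsonNode (l : ℚ) x) =
      (-1) ^ x * x.factorial * d.factorial * (2 * l + 2 * x + 1 + d).factorial /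
        ((2 * l + x).factorial * (2 * l + 2 * x + 1)) := by
  have hbelow : ∏ b ∈ Finset.range x, (watsonNode (l : ℚ) b - watsonNode (l : ℚ) x) =
      (-1) ^ x * x.factorial * ((2 * l + 2 * x).factorial / (2 * l + x).factorial) := by
    simp_rw [watsonNode_sub]
    exact_mod_cast prod_range_sub_mul_add (2 * l) x
  have habove : ∏ i ∈ Finset.range d, (watsonNode (l : ℚ) (x + 1 + i) - watsonNode (l : ℚ) x) =
      d.factorial * ((2 * l + 2 * x + 1 + d).factorial / (2 * l + 2 * x + 1).factorial) := by
    have h₁ := risingFactorial_natCast_add_one 0 d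
    have h₂ := risingFactorial_natCast_add_one (2 * l + 2 * x + 1) d
    rw [zero_add, Nat.factorial_zero, Nat.cast_one, div_one] at h₁
    rw [← h₁, ← h₂, risingFactorial, risingFactorial, ← Finset.prod_mul_distrib]
    refine Finset.prod_congr rfl fun i _ => ?_
    rw [watsonNode_sub]
    push_cast
    ring
  rw [prod_range_erase, hbelow, habove, Nat.factorial_succ (2 * l + 2 * x)]
  push_cast
  field_simp

lemma lagrangeWeight_watsonNode (l x d : ℕ) :
    lagrangeWeight (Finset.range (x + 1 + d)) (watsonNode (l : ℚ)) x =
      4 * (-1) ^ x * (2 * l + x).factorial *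
        (centralRatio (l + (x + 1 + d)) * (l + (x + 1 + d)).factorial) ^ 2 /
      ((centralRatio l * l.factorial) ^ 2 * x.factorial * d.factorial *
        (2 * l + 2 * x + 1 + d).factorial * (2 * l + 2 * x + 1)) := by
  have hinv (b : ℕ) : (1 - watsonNode (l : ℚ) x / watsonNode (l : ℚ) b)⁻¹ =
      watsonNode (l : ℚ) b / (watsonNode (l : ℚ) b - watsonNode (l : ℚ) x) := by
    rw [one_sub_div (watsonNode_pos (Nat.cast_nonneg l) b).ne', inv_div]
  have := centralRatio_ne_zero l
  rw [lagrangeWeight]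
  simp_rw [hinv]
  rw [Finset.prod_div_distrib, prod_erase_watsonNode, prod_erase_watsonNode_sub, watsonNode]
  rcases neg_one_pow_eq_or ℚ x with hsign | hsign <;>
  · rw [hsign]
    field_simp
    ring

lemma watsonSum_mul_lagrangeWeight (l M d : ℕ) {L : ℕ} (hL : L = l + (2 * M + 1 + d)) :
    watsonSum (l : ℚ) (2 * M) *
        lagrangeWeight (Finset.range (2 * M + 1 + d)) (watsonNode (l : ℚ)) (2 * M) =
      8 * L * 4 ^ l / 4 ^ L * centralRatio L * (2 * L - 1).choose d * centralRatio M *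
        centralRatio (l + M) / (centralRatio l ^ 2 * (2 * l + 4 * M + 1)) := by
  have hchoose : ((l + M).choose M : ℚ) = (l + M).factorial / (M.factorial * l.factorial) := by
    rw [Nat.cast_choose ℚ (Nat.le_add_left M l), Nat.add_sub_cancel]
  have htop : 2 * L * ((2 * L - 1).choose d : ℚ) *
      (d.factorial * (2 * l + 2 * (2 * M) + 1 + d).factorial) =
        centralRatio L * 4 ^ L * L.factorial ^ 2 := by
    rw [← factorial_two_mul_eq_centralRatio, ← Nat.mul_factorial_pred (show 2 * L ≠ 0 by omega),
      ← Nat.choose_mul_factorial_mul_factorial (show d ≤ 2 * L - 1 by omega),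
      show 2 * L - 1 - d = 2 * l + 2 * (2 * M) + 1 + d by omega]
    push_cast
    ring
  have hl := centralRatio_ne_zero l
  have hM := centralRatio_ne_zero M
  have hlM := centralRatio_ne_zero (l + M)
  rw [watsonSum_natCast_even, lagrangeWeight_watsonNode, ← hL, hchoose, ← mul_add 2 l M,
    factorial_two_mul_eq_centralRatio, factorial_two_mul_eq_centralRatio]
  rw [pow_mul, neg_one_sq, one_pow]
  push_cast
  field_simp
  linear_combination -(4 ^ (l + M + 1) * centralRatio L * (2 * l + 4 * M + 1)) * htop

end CentralRatio

section Expansion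

lemma watsonTerm_zero_zero (t : ℕ) : watsonTerm (0 : ℚ) 0 t = centralRatio t ^ 3 := by
  induction t with
  | zero => simp [watsonTerm, centralRatio_zero]
  | succ t ih =>
    rw [watsonTerm_succ, ih, centralRatio_succ]
    field_simp
    ring

lemma sum_range_centralRatio_pow_three (D : ℕ) :
    ∑ k ∈ Finset.range D, centralRatio k ^ 3 =
      ∑ j ∈ Finset.range D,
        watsonSum (0 : ℚ) j * lagrangeWeight (Finset.range D) (watsonNode 0) j := by
  rw [← sum_watsonTerm_zero le_rfl]
  exact Finset.sum_congr rfl fun k _ => (watsonTerm_zero_zero k).symm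

lemma watsonSum_zero_mul_lagrangeWeight (M d : ℕ) {N : ℕ} (hN : N = 2 * M + d) :
    watsonSum (0 : ℚ) (2 * M) *
        lagrangeWeight (Finset.range (N + 1)) (watsonNode 0) (2 * M) =
      (2 * N + 1 : ℕ) * (2 * N + 1).choose d * centralRatio M ^ 2 * (centralRatio N / 4 ^ N) /
        (4 * M + 1 : ℕ) := by
  have h := watsonSum_mul_lagrangeWeight 0 M d (L := N + 1) (by omega)
  rw [show 2 * M + 1 + d = N + 1 by omega, Nat.cast_zero] at h
  rw [h, show 2 * (N + 1) - 1 = 2 * N + 1 by omega, centralRatio_succ, centralRatio_zero,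
    zero_add]
  push_cast
  field_simp
  ring

lemma centralRatio_add_pow_three (l t : ℕ) :
    centralRatio (l + t) ^ 3 = centralRatio l ^ 3 *
      (∏ i ∈ Finset.Ico (l + 1) (l + t + 1), (1 - (l : ℚ) ^ 2 / (i : ℚ) ^ 2)) *
        watsonTerm (l : ℚ) 0 t := by
  induction t with
  | zero => simp [watsonTerm]
  | succ t ih =>
    rw [← add_assoc, Finset.prod_Ico_succ_top (by omega), centralRatio_succ, mul_pow, ih,
      watsonTerm_succ]
    push_cast
    field_simp
    ring

lemma sum_Ico_centralRatio_pow_three_mul_prod {A l n : ℕ} (hl : l ∈ Finset.Ico A n) :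
    ∑ k ∈ Finset.Ico A n,
        centralRatio k ^ 3 * ∏ i ∈ Finset.Ico (k + 1) n, (1 - (l : ℚ) ^ 2 / (i : ℚ) ^ 2) =
      centralRatio l ^ 3 * (∑ t ∈ Finset.range (n - l), watsonTerm (l : ℚ) 0 t) *
        ∏ i ∈ Finset.Ico (l + 1) n, (1 - (l : ℚ) ^ 2 / (i : ℚ) ^ 2) := by
  rw [Finset.mem_Ico] at hl
  have hvanish (k : ℕ) (hk : k ∈ Finset.Ico A l) :
      centralRatio k ^ 3 * ∏ i ∈ Finset.Ico (k + 1) n, (1 - (l : ℚ) ^ 2 / (i : ℚ) ^ 2) = 0 := by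
    rw [Finset.mem_Ico] at hk
    have hl0 : (l : ℚ) ≠ 0 := Nat.cast_ne_zero.2 (by omega)
    rw [Finset.prod_eq_zero (Finset.mem_Ico.2 ⟨hk.2, hl.2⟩) (by field_simp; ring), mul_zero]
  rw [← Finset.sum_Ico_consecutive _ hl.1 hl.2.le, Finset.sum_eq_zero hvanish, zero_add,
    Finset.sum_Ico_eq_sum_range, Finset.mul_sum, Finset.sum_mul]
  refine Finset.sum_congr rfl fun t ht => ?_
  rw [Finset.mem_range] at ht
  rw [centralRatio_add_pow_three, ← Finset.prod_Ico_consecutive _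
    (show l + 1 ≤ l + t + 1 by omega) (show l + t + 1 ≤ n by omega)]
  ring

lemma lagrangeWeight_sq_mul_prod {A l n : ℕ} (hl : l ∈ Finset.Ico A n) :
    lagrangeWeight (Finset.Ico A n) (fun i => (i : ℚ) ^ 2) l *
        ∏ i ∈ Finset.Ico (l + 1) n, (1 - (l : ℚ) ^ 2 / (i : ℚ) ^ 2) =
      ∏ i ∈ Finset.Ico A l, (1 - (l : ℚ) ^ 2 / (i : ℚ) ^ 2)⁻¹ := by
  rw [Finset.mem_Ico] at hl
  have herase : (Finset.Ico A n).erase l = (Finset.Ico A l).disjUnion (Finset.Ico (l + 1) n)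
      (Finset.disjoint_left.2 fun i => by simp; omega) := by
    ext i
    simp only [Finset.mem_erase, Finset.mem_Ico, Finset.mem_disjUnion]
    omega
  have hne (i : ℕ) (hi : i ∈ Finset.Ico (l + 1) n) : 1 - (l : ℚ) ^ 2 / (i : ℚ) ^ 2 ≠ 0 := by
    rw [Finset.mem_Ico] at hi
    have hlt : (l : ℚ) ^ 2 < (i : ℚ) ^ 2 := by
      exact_mod_cast Nat.pow_lt_pow_left hi.1 two_ne_zero
    exact (sub_pos.2 ((div_lt_one ((sq_nonneg _).trans_lt hlt)).2 hlt)).ne'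
  rw [lagrangeWeight, herase, Finset.prod_disjUnion, mul_assoc, ← Finset.prod_mul_distrib,
    Finset.prod_congr rfl fun i hi => inv_mul_cancel₀ (hne i hi), Finset.prod_const_one, mul_one]

lemma sum_Ico_centralRatio_pow_three {A : ℕ} (hA : 1 ≤ A) (n : ℕ) :
    ∑ k ∈ Finset.Ico A n, centralRatio k ^ 3 =
      ∑ l ∈ Finset.Ico A n, centralRatio l ^ 3 *
        (∏ i ∈ Finset.Ico A l, (1 - (l : ℚ) ^ 2 / (i : ℚ) ^ 2)⁻¹) *
          ∑ j ∈ Finset.range (n - l),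
            watsonSum (l : ℚ) j * lagrangeWeight (Finset.range (n - l)) (watsonNode (l : ℚ)) j := by
  have hinj : Set.InjOn (fun i : ℕ => (i : ℚ) ^ 2) (Finset.Ico A n) := fun i _ j _ hij => by
    have h : (i : ℚ) = j := (pow_left_inj₀ (by positivity) (by positivity) two_ne_zero).1 hij
    exact_mod_cast h
  have hne (i : ℕ) (hi : i ∈ Finset.Ico A n) : (i : ℚ) ^ 2 ≠ 0 := by
    rw [Finset.mem_Ico] at hi
    exact pow_ne_zero 2 (Nat.cast_ne_zero.2 (by omega))
  have hcard (k : ℕ) (hk : k ∈ Finset.Ico A n) :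
      (Finset.Ico (k + 1) n).card < (Finset.Ico A n).card := by
    rw [Finset.mem_Ico] at hk
    rw [Nat.card_Ico, Nat.card_Ico]
    omega
  rw [sum_eq_sum_mul_lagrangeWeight hinj hne _ _ hcard]
  refine Finset.sum_congr rfl fun l hl => ?_
  rw [sum_Ico_centralRatio_pow_three_mul_prod hl, ← lagrangeWeight_sq_mul_prod hl,
    sum_watsonTerm_zero (Nat.cast_nonneg l)]
  ring

lemma prod_range_sq_sub_sq (N q : ℕ) {l : ℕ} (hl : l = N + 1 + q) :
    ∏ i ∈ Finset.range q, (((N + 1 + i : ℕ) : ℚ) ^ 2 - (l : ℚ) ^ 2) =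
      (-1) ^ q * q.factorial * ((2 * l).factorial / (2 * l * (N + l).factorial)) := by
  rw [show 2 * l = 2 * N + 1 + 2 * q + 1 by omega, Nat.factorial_succ,
    show N + l = 2 * N + 1 + q by omega, hl]
  have h := prod_range_sub_mul_add (2 * N + 1) q
  push_cast at h ⊢
  rw [← mul_div_mul_left _ _ (show (2 * N + 1 + 2 * q + 1 : ℚ) ≠ 0 by positivity)] at h
  rw [show 2 * (N + 1 + q : ℚ) = 2 * N + 1 + 2 * q + 1 by ring, ← h]
  refine Finset.prod_congr rfl fun i _ => ?_
  ring

lemma prod_Ico_one_sub_sq_inv (N q : ℕ) {l : ℕ} (hl : l = N + 1 + q) :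
    ∏ i ∈ Finset.Ico (N + 1) l, (1 - (l : ℚ) ^ 2 / (i : ℚ) ^ 2)⁻¹ =
      (-1) ^ q * (2 / l) * (N + l).choose q * (2 * N + 1) * (4 ^ N * centralRatio N) /
        (4 ^ l * centralRatio l) := by
  have hnum : ∏ i ∈ Finset.range q, ((N + 1 + i : ℕ) : ℚ) = l.factorial / (l * N.factorial) := by
    have h := risingFactorial_natCast_add_one N q
    rw [risingFactorial] at h
    push_cast
    rw [h, hl, show N + 1 + q = N + q + 1 by ring, Nat.factorial_succ]
    push_cast
    field_simp
  have hl0 : (l : ℚ) ≠ 0 := Nat.cast_ne_zero.2 (by omega)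
  have hN := factorial_two_mul_eq_centralRatio N
  have := centralRatio_ne_zero l
  calc ∏ i ∈ Finset.Ico (N + 1) l, (1 - (l : ℚ) ^ 2 / (i : ℚ) ^ 2)⁻¹
      = ∏ i ∈ Finset.range q,
          (((N + 1 + i : ℕ) : ℚ) ^ 2 / (((N + 1 + i : ℕ) : ℚ) ^ 2 - (l : ℚ) ^ 2)) := by
        rw [Finset.prod_Ico_eq_prod_range, show l - (N + 1) = q by omega]
        refine Finset.prod_congr rfl fun i _ => ?_
        rw [one_sub_div (by positivity), inv_div]
    _ = _ := by
        rw [Finset.prod_div_distrib, Finset.prod_pow, hnum, prod_range_sq_sub_sq N q hl,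
          factorial_two_mul_eq_centralRatio,
          Nat.cast_choose ℚ (show q ≤ N + l by omega), show N + l - q = 2 * N + 1 by omega,
          Nat.factorial_succ]
        push_cast
        rw [hN]
        rcases neg_one_pow_eq_or ℚ q with hsign | hsign <;>
        · rw [hsign]
          have := centralRatio_ne_zero N
          field_simp

lemma centralRatio_pow_three_mul_watsonSum_mul_lagrangeWeight (N q M d : ℕ) {l n : ℕ}
    (hl : l = N + 1 + q) (hn : n = 2 * N + 1)
    (hd : n = l + (2 * M + 1 + d)) :
    centralRatio l ^ 3 * (∏ i ∈ Finset.Ico (N + 1) l, (1 - (l : ℚ) ^ 2 / (i : ℚ) ^ 2)⁻¹) *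
        (watsonSum (l : ℚ) (2 * M) *
          lagrangeWeight (Finset.range (2 * M + 1 + d)) (watsonNode (l : ℚ)) (2 * M)) =
      (-1) ^ q * ((16 * (N + l).choose q * (2 * n - 1).choose d * 4 ^ N : ℕ) *
        (centralRatio N * centralRatio n / 4 ^ n) *
          ((n : ℚ) ^ 2 * (centralRatio M * centralRatio (l + M)) / l /
            (2 * l + 4 * M + 1 : ℕ))) := by
  have := centralRatio_ne_zero l
  have hl0 : (l : ℚ) ≠ 0 := Nat.cast_ne_zero.2 (by omega)
  have hn' : (2 * N + 1 : ℚ) = n := by rw [hn]; push_cast; rfl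
  rw [watsonSum_mul_lagrangeWeight l M d hd, prod_Ico_one_sub_sq_inv N q hl, hn']
  push_cast
  field_simp
  ring

end Expansion

section RisingFactorial

lemma risingFactorial_add_two (a : ℚ) (k : ℕ) :
    risingFactorial a (k + 2) = a * (a + k + 1) * risingFactorial (a + 1) k := by
  rw [risingFactorial, Finset.prod_range_succ, Finset.prod_range_succ', risingFactorial]
  push_cast
  simp only [add_assoc, add_comm (1 : ℚ)]
  ring

lemma risingFactorial_two_mul (a : ℚ) (M : ℕ) :
    risingFactorial a (2 * M) =
      ∏ j ∈ Finset.range M, ((a + M - 1 / 2) ^ 2 - (j + 1 / 2 : ℚ) ^ 2) := by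
  induction M generalizing a with
  | zero => rfl
  | succ M ih =>
    rw [mul_add_one, risingFactorial_add_two, ih, Finset.prod_range_succ, mul_comm]
    push_cast
    congr 1
    · exact Finset.prod_congr rfl fun j _ => by ring
    · ring

lemma risingFactorial_two_mul_add_one (a : ℚ) (M : ℕ) :
    risingFactorial a (2 * M + 1) =
      (a + M) * ∏ j ∈ Finset.range M, ((a + M) ^ 2 - (j + 1 : ℚ) ^ 2) := by
  induction M generalizing a with
  | zero => simp [risingFactorial]
  | succ M ih =>
    rw [mul_add_one, add_right_comm, risingFactorial_add_two, ih, Finset.prod_range_succ]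
    push_cast
    rw [show a + 1 + (M : ℚ) = a + (M + 1) by ring]
    ring

lemma risingFactorial_five_fourths (M : ℕ) :
    risingFactorial (5 / 4) (2 * M) =
      (4 * M + 1) * ∏ j ∈ Finset.range M, ((1 / 4 + M : ℚ) ^ 2 - (j + 1 : ℚ) ^ 2) := by
  have h := risingFactorial_two_mul_add_one (1 / 4) M
  rw [risingFactorial, Finset.prod_range_succ'] at h
  have hshift : risingFactorial (5 / 4) (2 * M) =
      ∏ i ∈ Finset.range (2 * M), (1 / 4 + ((i + 1 : ℕ) : ℚ)) :=
    Finset.prod_congr rfl fun i _ => by push_cast; ring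
  rw [← hshift, Nat.cast_zero] at h
  linear_combination 4 * h

lemma mul_risingFactorial_div_risingFactorial (M : ℕ) :
    (4 * M + 1 : ℚ) * (risingFactorial (3 / 4) (2 * M) / risingFactorial (5 / 4) (2 * M)) =
      centralRatio M ^ 2 * ∏ j ∈ Finset.range M,
        ((1 - (4 * M + 1 : ℚ) ^ 2 / (4 * j + 2) ^ 2) *
          (1 - (4 * M + 1 : ℚ) ^ 2 / (4 * j + 4) ^ 2)⁻¹) := by
  have hratio := prod_range_odd_div_even 0 M
  rw [zero_add, Nat.choose_self, Nat.cast_one, div_one] at hratio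
  have hne : (4 * M + 1 : ℚ) ≠ 0 := by positivity
  rw [risingFactorial_five_fourths, risingFactorial_two_mul, ← mul_div_assoc,
    mul_div_mul_left _ _ hne, ← Finset.prod_div_distrib, ← hratio, ← Finset.prod_pow,
    ← Finset.prod_mul_distrib]
  refine Finset.prod_congr rfl fun j _ => ?_
  have hnum : 1 - (4 * M + 1 : ℚ) ^ 2 / (4 * j + 2) ^ 2 =
      -(4 / (4 * j + 2)) ^ 2 * ((3 / 4 + M - 1 / 2) ^ 2 - (j + 1 / 2) ^ 2) := by
    field_simp
    ring
  have hden : 1 - (4 * M + 1 : ℚ) ^ 2 / (4 * j + 4) ^ 2 =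
      -(4 / (4 * j + 4)) ^ 2 * ((1 / 4 + M) ^ 2 - (j + 1) ^ 2) := by
    field_simp
    ring
  rw [hnum, hden, div_eq_mul_inv, mul_inv, Nat.cast_zero, mul_zero, zero_add]
  generalize ((1 / 4 + M : ℚ) ^ 2 - (j + 1) ^ 2)⁻¹ = D
  field_simp
  ring

end RisingFactorial

section PadicFractionalIdeal

variable {p : ℕ} [hp : Fact p.Prime] {a b c : ℤ} {x y : ℚ}

/-- The fractional ideal `p ^ e ℤ_(p)` of `ℚ`, that is, the rational numbers whose `p`-adic
valuation is at least `e`. Congruences modulo powers of `p` between rational numbers with arbitrary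
denominators are expressed by membership in it. -/
def padicFractionalIdeal (p : ℕ) [Fact p.Prime] (e : ℤ) : AddSubgroup ℚ where
  carrier := {x | padicNorm p x ≤ (p : ℚ) ^ (-e)}
  zero_mem' := by
    simp only [Set.mem_ofPred_eq, padicNorm.zero]
    positivity
  add_mem' hx hy := padicNorm.nonarchimedean.trans (max_le hx hy)
  neg_mem' hx := by rwa [Set.mem_ofPred_eq, padicNorm.neg]

lemma mem_padicFractionalIdeal : x ∈ padicFractionalIdeal p a ↔ padicNorm p x ≤ (p : ℚ) ^ (-a) :=
  Iff.rfl

lemma padicFractionalIdeal_antitone : Antitone (padicFractionalIdeal p) := fun _ _ h _ hx => by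
  have hp1 : (1 : ℚ) ≤ p := mod_cast hp.out.one_le
  exact le_trans hx (zpow_le_zpow_right₀ hp1 (neg_le_neg h))

lemma mul_mem_padicFractionalIdeal (hx : x ∈ padicFractionalIdeal p a)
    (hy : y ∈ padicFractionalIdeal p b) : x * y ∈ padicFractionalIdeal p (a + b) := by
  have hp0 : (p : ℚ) ≠ 0 := Nat.cast_ne_zero.2 hp.out.ne_zero
  rw [mem_padicFractionalIdeal, padicNorm.mul, neg_add, zpow_add₀ hp0]
  exact mul_le_mul hx hy (padicNorm.nonneg _) (by positivity)

lemma natCast_mem_padicFractionalIdeal {e m : ℕ} (h : p ^ e ∣ m) :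
    (m : ℚ) ∈ padicFractionalIdeal p e := by
  have hz := padicNorm.dvd_iff_norm_le.1 (Int.natCast_dvd_natCast.2 h)
  exact_mod_cast hz

lemma div_natCast_mem_padicFractionalIdeal {m : ℕ} (hx : x ∈ padicFractionalIdeal p a)
    (h : c + padicValNat p m ≤ a) : x / m ∈ padicFractionalIdeal p c := by
  rcases eq_or_ne m 0 with rfl | hm
  · simp [zero_mem]
  have hnorm : padicNorm p (m : ℚ)⁻¹ = (p : ℚ) ^ (padicValNat p m : ℤ) := by
    rw [padicNorm.eq_zpow_of_nonzero (inv_ne_zero (Nat.cast_ne_zero.2 hm)), padicValRat.inv,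
      padicValRat.of_nat, neg_neg]
  have hinv : (m : ℚ)⁻¹ ∈ padicFractionalIdeal p (-padicValNat p m) := by
    rw [mem_padicFractionalIdeal, hnorm, neg_neg]
  rw [div_eq_mul_inv]
  exact padicFractionalIdeal_antitone (by omega) (mul_mem_padicFractionalIdeal hx hinv)

lemma div_four_pow_mem_padicFractionalIdeal (hp2 : p ≠ 2) (k : ℕ)
    (hx : x ∈ padicFractionalIdeal p a) : x / 4 ^ k ∈ padicFractionalIdeal p a := by
  have hval : padicValNat p (4 ^ k) = 0 := by
    refine padicValNat.eq_zero_of_not_dvd fun h => hp2 ?_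
    have h2 : p ∣ 2 ^ 2 := hp.out.dvd_of_dvd_pow h
    exact (Nat.prime_dvd_prime_iff_eq hp.out Nat.prime_two).1 (hp.out.dvd_of_dvd_pow h2)
  have h := div_natCast_mem_padicFractionalIdeal (m := 4 ^ k) (c := a) hx (by simp [hval])
  exact_mod_cast h

lemma centralRatio_mem_padicFractionalIdeal (hp2 : p ≠ 2) {e M : ℕ}
    (h : e ≤ padicValNat p M.centralBinom) : centralRatio M ∈ padicFractionalIdeal p e :=
  div_four_pow_mem_padicFractionalIdeal hp2 M
    (natCast_mem_padicFractionalIdeal ((pow_dvd_pow p h).trans pow_padicValNat_dvd))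

lemma ratModEq_of_sub_mem {e : ℕ} (h : x - y ∈ padicFractionalIdeal p e) :
    RatModEq (p ^ e) x y := by
  rw [RatModEq, padicNorm.dvd_iff_norm_le]
  refine le_trans ?_ h
  rw [← Rat.mul_den_eq_num (x - y), padicNorm.mul]
  exact mul_le_of_le_one_right (padicNorm.nonneg _) (padicNorm.of_nat _)

lemma mul_sub_one_mem_padicFractionalIdeal (ha : 0 ≤ a) (hx : x - 1 ∈ padicFractionalIdeal p a)
    (hy : y - 1 ∈ padicFractionalIdeal p a) : x * y - 1 ∈ padicFractionalIdeal p a := by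
  have h : x * y - 1 = (x - 1) * (y - 1) + (x - 1) + (y - 1) := by ring
  rw [h]
  exact add_mem (add_mem (padicFractionalIdeal_antitone (by omega)
    (mul_mem_padicFractionalIdeal hx hy)) hx) hy

lemma prod_sub_one_mem_padicFractionalIdeal {ι : Type*} {s : Finset ι} {f : ι → ℚ} (ha : 0 ≤ a)
    (h : ∀ i ∈ s, f i - 1 ∈ padicFractionalIdeal p a) :
    ∏ i ∈ s, f i - 1 ∈ padicFractionalIdeal p a :=
  Finset.prod_induction _ (fun x => x - 1 ∈ padicFractionalIdeal p a)
    (fun _ _ => mul_sub_one_mem_padicFractionalIdeal ha) (by simp [zero_mem]) h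

lemma inv_sub_one_mem_padicFractionalIdeal (ha : 0 < a) (hx : x - 1 ∈ padicFractionalIdeal p a) :
    x⁻¹ - 1 ∈ padicFractionalIdeal p a := by
  have hlt : padicNorm p (x - 1) < 1 :=
    lt_of_le_of_lt hx (zpow_lt_one_of_neg₀ (mod_cast hp.out.one_lt) (by omega))
  have hnorm : padicNorm p x = 1 := by
    have h := padicNorm.add_eq_max_of_ne (p := p) (q := x - 1) (r := 1)
      (by rw [padicNorm.one]; exact hlt.ne)
    rwa [sub_add_cancel, padicNorm.one, max_eq_right hlt.le] at h
  have hx0 : x ≠ 0 := by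
    rintro rfl
    simp at hnorm
  have hinv : x⁻¹ - 1 = -(x - 1) / x := by
    field_simp
    ring
  rw [mem_padicFractionalIdeal, hinv, padicNorm.div, hnorm, div_one]
  exact neg_mem hx

end PadicFractionalIdeal

section Carries

variable {p : ℕ}

lemma pow_two_mul_mod_four (hp4 : p % 4 = 3) (j : ℕ) : p ^ (2 * j) % 4 = 1 := by
  rw [pow_mul, Nat.pow_mod, Nat.pow_mod p, hp4]
  norm_num

lemma pow_two_mul_add_one_mod_four (hp4 : p % 4 = 3) (j : ℕ) : p ^ (2 * j + 1) % 4 = 3 := by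
  rw [pow_succ, Nat.mul_mod, pow_two_mul_mod_four hp4, hp4]

-- Since `4 (M mod P) + 1` is a multiple `c P` of `P = p ^ (2 j + 1) ≡ 3 (mod 4)`, the cofactor
-- satisfies `c ≡ 3 (mod 4)`, hence `c ≥ 3`.
lemma pow_le_two_mul_mod_of_dvd (hp4 : p % 4 = 3) {j M : ℕ} (h : p ^ (2 * j + 1) ∣ 4 * M + 1) :
    p ^ (2 * j + 1) ≤ 2 * (M % p ^ (2 * j + 1)) := by
  have hP := pow_two_mul_add_one_mod_four hp4 j
  set P := p ^ (2 * j + 1)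
  have hmod : P ∣ 4 * (M % P) + 1 := by
    have hsplit : 4 * M + 1 = P * (4 * (M / P)) + (4 * (M % P) + 1) := by
      linarith [Nat.div_add_mod M P]
    exact (Nat.dvd_add_right (Dvd.intro _ rfl)).1 (hsplit ▸ h)
  obtain ⟨c, hc⟩ := hmod
  have hc3 : 3 ≤ c := by
    by_contra! hlt
    interval_cases c <;> omega
  have := Nat.mul_le_mul_left P hc3
  omega

lemma carry_of_mem_image_odd (hp4 : p % 4 = 3) {g M i : ℕ} (hM : p ^ g ∣ 4 * M + 1)
    (hi : i ∈ (Finset.range ((g + 1) / 2)).image (2 * · + 1)) :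
    i ≠ 0 ∧ p ^ i ≤ 2 * (M % p ^ i) := by
  obtain ⟨j, hj, rfl⟩ := Finset.mem_image.1 hi
  rw [Finset.mem_range] at hj
  exact ⟨by omega, pow_le_two_mul_mod_of_dvd hp4 ((pow_dvd_pow p (by omega)).trans hM)⟩

lemma card_image_odd (k : ℕ) : ((Finset.range k).image (2 * · + 1)).card = k := by
  rw [Finset.card_image_of_injective _ fun i j hij => by simpa using hij, Finset.card_range]

lemma padicValNat_lt_of_lt_two_mul_pow {m k : ℕ} (hlow : p ^ k < m) (hlt : m < 2 * p ^ k) :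
    padicValNat p m < k := by
  by_contra! hle
  obtain ⟨c, hc⟩ := (pow_dvd_pow p hle).trans pow_padicValNat_dvd
  have hc2 : 2 ≤ c := by
    by_contra! hc
    interval_cases c <;> omega
  have := Nat.mul_le_mul_left (p ^ k) hc2
  omega

variable [hp : Fact p.Prime]

lemma card_le_padicValNat_centralBinom {s : Finset ℕ} {M : ℕ}
    (hs : ∀ i ∈ s, i ≠ 0 ∧ p ^ i ≤ 2 * (M % p ^ i)) :
    s.card ≤ padicValNat p M.centralBinom := by
  rw [Nat.centralBinom, padicValNat_choose (b := 2 * M + 1) (by omega)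
    (Nat.lt_succ_of_le (Nat.log_le_self _ _)), show 2 * M - M = M by omega]
  refine Finset.card_le_card fun i hi => ?_
  obtain ⟨hi0, hcarry⟩ := hs i hi
  have hlt := Nat.lt_pow_self (n := i) hp.out.one_lt
  have hle := Nat.mod_le M (p ^ i)
  rw [Finset.mem_filter, Finset.mem_Ico]
  exact ⟨by omega, by rwa [← two_mul]⟩

lemma le_padicValNat_centralBinom (hp4 : p % 4 = 3) {g M : ℕ} (hM : p ^ g ∣ 4 * M + 1) :
    (g + 1) / 2 ≤ padicValNat p M.centralBinom := by
  rw [← card_image_odd ((g + 1) / 2)]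
  exact card_le_padicValNat_centralBinom fun i => carry_of_mem_image_odd hp4 hM

lemma lt_padicValNat_centralBinom (hp4 : p % 4 = 3) {g r M : ℕ} (hr : r ≠ 0)
    (hM : p ^ g ∣ 4 * M + 1) (hcarry : p ^ (2 * r) ≤ 2 * (M % p ^ (2 * r))) :
    (g + 1) / 2 < padicValNat p M.centralBinom := by
  have heven : 2 * r ∉ (Finset.range ((g + 1) / 2)).image (2 * · + 1) := by
    rw [Finset.mem_image]
    rintro ⟨j, _, hj⟩
    omega
  rw [← card_image_odd ((g + 1) / 2), ← Nat.add_one_le_iff, ← Finset.card_insert_of_notMem heven]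
  refine card_le_padicValNat_centralBinom fun i hi => ?_
  rcases Finset.mem_insert.1 hi with rfl | hi
  · exact ⟨by omega, hcarry⟩
  · exact carry_of_mem_image_odd hp4 hM hi

lemma padicValNat_lt_of_lt_pow {m k : ℕ} (hm : m ≠ 0) (hlt : m < p ^ k) : padicValNat p m < k :=
  (Nat.pow_lt_pow_iff_right hp.out.one_lt).1
    ((Nat.le_of_dvd (Nat.pos_of_ne_zero hm) pow_padicValNat_dvd).trans_lt hlt)

lemma padicValNat_choose_prime_pow {k d : ℕ} (hd : d ≠ 0) (hle : d ≤ p ^ k) :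
    padicValNat p ((p ^ k).choose d) = k - padicValNat p d := by
  rw [← Nat.factorization_def _ hp.out, ← Nat.factorization_def _ hp.out,
    Nat.factorization_choose_prime_pow hp.out hle hd]

end Carries

section Congruence

variable {p : ℕ} [hp : Fact p.Prime]

lemma watsonSum_zero_mul_lagrangeWeight_mem (hp4 : p % 4 = 3) {r N M d : ℕ}
    (hn : p ^ (2 * r) = 2 * N + 1) (hd : N = 2 * M + d) (hd0 : d ≠ 0) :
    watsonSum (0 : ℚ) (2 * M) * lagrangeWeight (Finset.range (N + 1)) (watsonNode 0) (2 * M) ∈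
      padicFractionalIdeal p (2 * r + 2) := by
  have hp2 : p ≠ 2 := by omega
  set g := padicValNat p (4 * M + 1)
  have hg : p ^ g ∣ 4 * M + 1 := pow_padicValNat_dvd
  have hg_lt : g < 2 * r := padicValNat_lt_of_lt_pow (by omega) (by omega)
  have hvd_lt : padicValNat p d < 2 * r := padicValNat_lt_of_lt_pow hd0 (by omega)
  have hvd_le : padicValNat p d ≤ g := by
    rw [← padicValNat_dvd_iff_le (by omega)]
    have hsum : p ^ padicValNat p d ∣ 4 * M + 1 + 2 * d := by
      rw [show 4 * M + 1 + 2 * d = p ^ (2 * r) by omega]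
      exact pow_dvd_pow p hvd_lt.le
    exact (Nat.dvd_add_left (pow_padicValNat_dvd.mul_left 2)).1 hsum
  have hnum : ((2 * N + 1 : ℕ) : ℚ) ∈ padicFractionalIdeal p (2 * r : ℕ) :=
    natCast_mem_padicFractionalIdeal (dvd_of_eq hn)
  have hchoose : ((2 * N + 1).choose d : ℚ) ∈
      padicFractionalIdeal p (2 * r - padicValNat p d : ℕ) := by
    rw [← hn, ← padicValNat_choose_prime_pow hd0 (by omega)]
    exact natCast_mem_padicFractionalIdeal pow_padicValNat_dvd
  have hM := centralRatio_mem_padicFractionalIdeal hp2 (le_padicValNat_centralBinom hp4 hg)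
  have hN := div_four_pow_mem_padicFractionalIdeal hp2 N
    (centralRatio_mem_padicFractionalIdeal hp2 (Nat.zero_le (padicValNat p N.centralBinom)))
  rw [watsonSum_zero_mul_lagrangeWeight M d hd, sq]
  refine div_natCast_mem_padicFractionalIdeal (mul_mem_padicFractionalIdeal
    (mul_mem_padicFractionalIdeal (mul_mem_padicFractionalIdeal hnum hchoose)
      (mul_mem_padicFractionalIdeal hM hM)) hN) ?_
  change 2 * (r : ℤ) + 2 + g ≤ _
  omega

lemma prime_pow_div_mem {k q : ℕ} (hq : q ≠ 0) (hlt : q < p ^ k) :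
    ((p ^ k : ℕ) : ℚ) / q ∈ padicFractionalIdeal p 1 := by
  have hpow : ((p ^ k : ℕ) : ℚ) ∈ padicFractionalIdeal p k :=
    natCast_mem_padicFractionalIdeal dvd_rfl
  have hval := padicValNat_lt_of_lt_pow hq hlt
  exact div_natCast_mem_padicFractionalIdeal hpow (by omega)

lemma one_sub_sq_div_sq_sub_one_mem {k q : ℕ} (hq : q ≠ 0) (hlt : q < p ^ k) :
    1 - ((p ^ k : ℕ) : ℚ) ^ 2 / (q : ℚ) ^ 2 - 1 ∈ padicFractionalIdeal p 2 := by
  have hratio := prime_pow_div_mem hq hlt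
  have hsq := mul_mem_padicFractionalIdeal hratio hratio
  rw [one_add_one_eq_two, ← sq, div_pow] at hsq
  rw [sub_right_comm, sub_self, zero_sub]
  exact neg_mem hsq

lemma lagrangeWeight_watsonNode_zero_sub_one_mem {k D : ℕ} (hn : p ^ k = 2 * D + 1) :
    lagrangeWeight (Finset.range (D + 1)) (watsonNode (0 : ℚ)) D - 1 ∈
      padicFractionalIdeal p 2 := by
  refine prod_sub_one_mem_padicFractionalIdeal zero_le_two fun b hb =>
    inv_sub_one_mem_padicFractionalIdeal zero_lt_two ?_
  rw [Finset.mem_erase, Finset.mem_range] at hb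
  have hnode : watsonNode (0 : ℚ) D / watsonNode 0 b =
      ((p ^ k : ℕ) : ℚ) ^ 2 / ((2 * b + 1 : ℕ) : ℚ) ^ 2 := by
    rw [watsonNode, watsonNode, hn]
    push_cast
    field_simp
    ring
  rw [hnode]
  exact one_sub_sq_div_sq_sub_one_mem (by omega) (by omega)

lemma prod_one_sub_sq_div_sub_one_mem {k M : ℕ} (hn : p ^ k = 4 * M + 1) :
    ∏ j ∈ Finset.range M, ((1 - (4 * M + 1 : ℚ) ^ 2 / (4 * j + 2) ^ 2) *
      (1 - (4 * M + 1 : ℚ) ^ 2 / (4 * j + 4) ^ 2)⁻¹) - 1 ∈ padicFractionalIdeal p 2 := by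
  refine prod_sub_one_mem_padicFractionalIdeal zero_le_two fun j hj => ?_
  rw [Finset.mem_range] at hj
  have hnum := one_sub_sq_div_sq_sub_one_mem (show 4 * j + 2 ≠ 0 by omega)
    (show 4 * j + 2 < p ^ k by omega)
  have hden := one_sub_sq_div_sq_sub_one_mem (show 4 * j + 4 ≠ 0 by omega)
    (show 4 * j + 4 < p ^ k by omega)
  rw [hn] at hnum hden
  exact_mod_cast mul_sub_one_mem_padicFractionalIdeal zero_le_two hnum
    (inv_sub_one_mem_padicFractionalIdeal zero_lt_two hden)

lemma sum_range_centralRatio_pow_three_sub_mem (hp4 : p % 4 = 3) {r M : ℕ}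
    (hn : p ^ (2 * r) = 4 * M + 1) :
    ∑ k ∈ Finset.range (2 * M + 1), centralRatio k ^ 3 - (p : ℚ) ^ (2 * r) *
        (risingFactorial (3 / 4) (2 * M) / risingFactorial (5 / 4) (2 * M)) ∈
      padicFractionalIdeal p (2 * r + 2) := by
  have hp2 : p ≠ 2 := by omega
  have hn' : (p : ℚ) ^ (2 * r) = 4 * M + 1 := by exact_mod_cast hn
  have hsq : centralRatio M ^ 2 ∈ padicFractionalIdeal p (2 * r) := by
    have hval := le_padicValNat_centralBinom hp4 (dvd_of_eq hn)
    have h := centralRatio_mem_padicFractionalIdeal hp2 (e := r) (M := M) (by omega)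
    rw [sq, two_mul]
    exact mul_mem_padicFractionalIdeal h h
  have htop : watsonSum (0 : ℚ) (2 * M) = centralRatio M ^ 2 := by
    have h := watsonSum_natCast_even 0 M
    rwa [Nat.cast_zero, zero_add, Nat.choose_self, Nat.cast_one, div_one] at h
  rw [hn', mul_risingFactorial_div_risingFactorial, sum_range_centralRatio_pow_three,
    Finset.sum_range_succ, htop, add_sub_assoc, ← mul_sub]
  refine add_mem (sum_mem fun j hj => ?_) (mul_mem_padicFractionalIdeal hsq ?_)
  · rw [Finset.mem_range] at hj
    rcases Nat.even_or_odd' j with ⟨i, rfl | rfl⟩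
    · exact watsonSum_zero_mul_lagrangeWeight_mem hp4 (d := 2 * M - 2 * i) (by omega) (by omega)
        (by omega)
    · rw [watsonSum_odd le_rfl, zero_mul]
      exact zero_mem _
  · have h := sub_mem (lagrangeWeight_watsonNode_zero_sub_one_mem (p := p) (k := 2 * r)
      (D := 2 * M) (by omega)) (prod_one_sub_sq_div_sub_one_mem hn)
    rwa [sub_sub_sub_cancel_right] at h

lemma prime_pow_sq_mul_centralRatio_div_mem (hp4 : p % 4 = 3) {r l M : ℕ}
    (hl : p ^ (2 * r) < 2 * l) (hM : l + 2 * M < p ^ (2 * r)) :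
    ((p ^ (2 * r) : ℕ) : ℚ) ^ 2 * (centralRatio M * centralRatio (l + M)) / l /
        (2 * l + 4 * M + 1 : ℕ) ∈ padicFractionalIdeal p (2 * r + 2) := by
  have hp2 : p ≠ 2 := by omega
  have hr : r ≠ 0 := by
    rintro rfl
    rw [mul_zero, pow_zero] at hl hM
    omega
  set e := padicValNat p l with he
  set g := padicValNat p (2 * l + 4 * M + 1)
  have he_lt : e < 2 * r := padicValNat_lt_of_lt_pow (by omega) (by omega)
  have hg_lt : g < 2 * r := padicValNat_lt_of_lt_two_mul_pow (by omega) (by omega)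
  have hdvd_l : p ^ min e g ∣ 2 * l :=
    ((pow_dvd_pow p (min_le_left e g)).trans pow_padicValNat_dvd).mul_left 2
  have hdvd_M : p ^ min e g ∣ 4 * M + 1 :=
    (Nat.dvd_add_right hdvd_l).1 (add_assoc (2 * l) (4 * M) 1 ▸
      (pow_dvd_pow p (min_le_right e g)).trans pow_padicValNat_dvd)
  have hdvd_lM : p ^ min e g ∣ 4 * (l + M) + 1 := by
    rw [show 4 * (l + M) + 1 = 2 * l + (2 * l + (4 * M + 1)) by ring]
    exact dvd_add hdvd_l (dvd_add hdvd_l hdvd_M)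
  have hval_M := le_padicValNat_centralBinom hp4 hdvd_M
  have hval_lM := lt_padicValNat_centralBinom hp4 hr hdvd_lM
    (by rw [Nat.mod_eq_of_lt (by omega)]; omega)
  have hpow : ((p ^ (2 * r) : ℕ) : ℚ) ∈ padicFractionalIdeal p (2 * r : ℕ) :=
    natCast_mem_padicFractionalIdeal dvd_rfl
  have hnum := mul_mem_padicFractionalIdeal (mul_mem_padicFractionalIdeal hpow hpow)
    (mul_mem_padicFractionalIdeal (centralRatio_mem_padicFractionalIdeal hp2 hval_M)
      (centralRatio_mem_padicFractionalIdeal hp2 hval_lM))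
  rw [← sq] at hnum
  refine div_natCast_mem_padicFractionalIdeal (a := 2 * r + 2 + g)
    (div_natCast_mem_padicFractionalIdeal hnum ?_) le_rfl
  rw [← he]
  push_cast
  omega

lemma centralRatio_pow_three_mul_watsonSum_mul_lagrangeWeight_mem (hp4 : p % 4 = 3)
    {r N q M d l : ℕ} (hn : p ^ (2 * r) = 2 * N + 1) (hl : l = N + 1 + q)
    (hd : 2 * N + 1 = l + (2 * M + 1 + d)) :
    centralRatio l ^ 3 * (∏ i ∈ Finset.Ico (N + 1) l, (1 - (l : ℚ) ^ 2 / (i : ℚ) ^ 2)⁻¹) *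
        (watsonSum (l : ℚ) (2 * M) *
          lagrangeWeight (Finset.range (2 * M + 1 + d)) (watsonNode (l : ℚ)) (2 * M)) ∈
      padicFractionalIdeal p (2 * r + 2) := by
  have hp2 : p ≠ 2 := by omega
  have hratio (k : ℕ) : centralRatio k ∈ padicFractionalIdeal p (0 : ℕ) :=
    centralRatio_mem_padicFractionalIdeal hp2 (Nat.zero_le _)
  have hcast (m : ℕ) : (m : ℚ) ∈ padicFractionalIdeal p (0 : ℕ) :=
    natCast_mem_padicFractionalIdeal (one_dvd m)
  have hunit := mul_mem_padicFractionalIdeal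
    (hcast (16 * (N + l).choose q * (2 * p ^ (2 * r) - 1).choose d * 4 ^ N))
    (div_four_pow_mem_padicFractionalIdeal hp2 (p ^ (2 * r))
      (mul_mem_padicFractionalIdeal (hratio N) (hratio (p ^ (2 * r)))))
  have hmem := mul_mem_padicFractionalIdeal hunit (prime_pow_sq_mul_centralRatio_div_mem
    (p := p) (r := r) (l := l) (M := M) hp4 (by omega) (by omega))
  rw [Nat.cast_zero, zero_add, zero_add, zero_add] at hmem
  rw [centralRatio_pow_three_mul_watsonSum_mul_lagrangeWeight N q M d hl hn (hn.trans hd)]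
  rcases neg_one_pow_eq_or ℚ q with hsign | hsign
  · rwa [hsign, one_mul]
  · rw [hsign, neg_one_mul]
    exact neg_mem hmem

lemma sum_Ico_centralRatio_pow_three_mem (hp4 : p % 4 = 3) {r N : ℕ}
    (hn : p ^ (2 * r) = 2 * N + 1) :
    ∑ k ∈ Finset.Ico (N + 1) (2 * N + 1), centralRatio k ^ 3 ∈
      padicFractionalIdeal p (2 * r + 2) := by
  rw [sum_Ico_centralRatio_pow_three (Nat.succ_pos N)]
  refine sum_mem fun l hl => ?_
  rw [Finset.mem_Ico] at hl
  rw [Finset.mul_sum]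
  refine sum_mem fun j hj => ?_
  rw [Finset.mem_range] at hj
  rcases Nat.even_or_odd' j with ⟨M, rfl | rfl⟩
  · obtain ⟨d, hd⟩ := Nat.exists_eq_add_of_le (Nat.succ_le_of_lt hj)
    rw [hd]
    exact centralRatio_pow_three_mul_watsonSum_mul_lagrangeWeight_mem hp4 hn (q := l - (N + 1))
      (by omega) (by omega)
  · rw [watsonSum_odd (Nat.cast_nonneg l), zero_mul, mul_zero]
    exact zero_mem _

end Congruence

theorem mainTheorem5 (p r : ℕ) (hp : p.Prime) (hp4 : p % 4 = 3) (hr : 1 ≤ r) :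
    RatModEq (p ^ (2 * r + 2))
        (∑ k ∈ Finset.range ((p ^ (2 * r) - 1) / 2 + 1),
          risingFactorial (1 / 2) k ^ 3 / (k.factorial : ℚ) ^ 3)
        ((p : ℚ) ^ (2 * r) * (risingFactorial (3 / 4) ((p ^ (2 * r) - 1) / 2) /
          risingFactorial (5 / 4) ((p ^ (2 * r) - 1) / 2))) ∧
      RatModEq (p ^ (2 * r + 2))
        (∑ k ∈ Finset.range (p ^ (2 * r)),
          risingFactorial (1 / 2) k ^ 3 / (k.factorial : ℚ) ^ 3)
        ((p : ℚ) ^ (2 * r) * (risingFactorial (3 / 4) ((p ^ (2 * r) - 1) / 2) /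
          risingFactorial (5 / 4) ((p ^ (2 * r) - 1) / 2))) := by
  have : Fact p.Prime := ⟨hp⟩
  obtain ⟨M, hM⟩ : ∃ M, p ^ (2 * r) = 4 * M + 1 := by
    have hmod := pow_two_mul_mod_four hp4 r
    exact ⟨p ^ (2 * r) / 4, by omega⟩
  have hhalf : (p ^ (2 * r) - 1) / 2 = 2 * M := by omega
  have hterm (k : ℕ) : risingFactorial (1 / 2) k ^ 3 / (k.factorial : ℚ) ^ 3 =
      centralRatio k ^ 3 := by
    rw [← div_pow, risingFactorial_half_div_factorial]
  have hlow := sum_range_centralRatio_pow_three_sub_mem hp4 hM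
  have htail := sum_Ico_centralRatio_pow_three_mem (N := 2 * M) hp4 (hM.trans (by ring))
  simp_rw [hhalf, hterm]
  refine ⟨ratModEq_of_sub_mem (mod_cast hlow), ratModEq_of_sub_mem ?_⟩
  rw [show p ^ (2 * r) = 2 * (2 * M) + 1 by omega,
    ← Finset.sum_range_add_sum_Ico _ (show 2 * M + 1 ≤ 2 * (2 * M) + 1 by omega),
    add_sub_right_comm]
  exact_mod_cast add_mem hlow htail
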